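/- **Notions.** Let $X_1,\dots,X_d$ be nonempty sets and $S\subseteq X_1\times\dots\times X_d$; write $\Pi_iS\subseteq X_i$ for the projections. A *solution* for $f:S\to\mathbb C$ is a tuple of functions $u_i:X_i\to\mathbb C$ with $$f(x_1,\dots,x_d)=u_1(x_1)+\dots+u_d(x_d)\quad\text{for all }(x_1,\dots,x_d)\in S. \tag{1}$$ $S$ is *good* if every $f:S\to\mathbb C$ has a solution, and *full* if it is a maximal good subset of $\Pi_1S\times\dots\times\Pi_dS$. A set $B$ contained in the disjoint union of the $\Pi_iS$ is a *boundary* of the good set $S$ if for every $f:S\to\mathbb C$ and every function $U:B\to\mathbb C$, equation (1) has a solution with values prescribed by $U$ on $B$, and this solution is unique on the sets $\Pi_iS$. Two points of $S$ are *related* in $S$ if some finite full subset of $S$ contains both; a good set $S$ is a *related set* if any two of its points are related in it. The *geodesic* between two points of a related set $S$ is the smallest related subset of $S$ that contains both; its *length* is its number of points. Let $x_1,x_2,x_3,x_4,\alpha_1,\alpha_2,\dots$ be distinct symbols. In a fourfold product put $$y_1=(x_1,x_2,x_3,x_4),\quad y_2=(x_1,x_2,\alpha_1,\alpha_2),\quad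 y_3=(\alpha_3,\alpha_4,x_3,\alpha_2),\quad y_4=(\alpha_3,\alpha_4,\alpha_1,x_4),$$ and, for $m\ge 2$, $$y_{4m-3}=(x_1,\alpha_{4m-4},\alpha_{4m-3},\alpha_{4m-2}),\qquad y_{4m-2}=(\alpha_{4m-5},x_2,\alpha_{4m-3},\alpha_{4m-2}),$$ $$y_{4m-1}=(\alpha_{4m-1},\alpha_{4m},x_3,\alpha_{4m-2}),\qquad y_{4m}=(\alpha_{4m-1},\alpha_{4m},\alpha_{4m-3},x_4).$$ For $n\ge1$ let $S_{4n}=\{y_1,\dots,y_{4n}\}$ and $z=z_n=(\alpha_{4n-1},x_2,\alpha_{4n-3},x_4)$. Let $A_{4n}$ be the $4n\times4n$ matrix whose rows correspond to $y_2,\dots,y_{4n},z$ and whose columns correspond to $\alpha_1,\dots,\alpha_{4n}$, with entry $1$ if the symbol occurs in the point and $0$ otherwise. **Theorem.** 1. For every $n\ge1$, the set $S_{4n}\cup\{z\}$ is full, has $\{x_1,x_2,x_3\}$ as a boundary, and is a related set; the geodesic in it between $y_1$ and $y_{4n}$ is the whole set $S_{4n}\cup\{z\}$. The matrix $A_{4n}$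 is invertible, and in every row of $A_{4n}^{-1}$ the sum of the absolute values of the entries is at most $3$, independently of $n$. 2. For every $d\ge4$, uniform boundedness of geodesic lengths is not necessary for boundedness of the solutions for bounded functions: there are nonempty sets $X_1,\dots,X_d$ and a full, related set $S\subseteq X_1\times\dots\times X_d$ such that the lengths of geodesics in $S$ are not bounded, while for every bounded $f:S\to\mathbb C$ and every solution $u_1,\dots,u_d$ of (1), each $u_i$ is bounded on $\Pi_iS$. -/

import Mathlib

namespace GoodSets

section General

variable {d : ℕ} {X : Fin d → Type*}

/-- The projection of `S ⊆ X₁ × ⋯ × X_d` to the `i`-th factor. -/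
def proj (S : Set (∀ i, X i)) (i : Fin d) : Set (X i) :=
  (fun p => p i) '' S

/-- `u₁, …, u_d` solve `f(p) = u₁(p₁) + ⋯ + u_d(p_d)` for all `p ∈ S`. -/
def IsSolution (S : Set (∀ i, X i)) (f : S → ℂ) (u : ∀ i, X i → ℂ) : Prop :=
  ∀ p : S, f p = ∑ i, u i (p.1 i)

/-- `S` is good: every complex function on `S` is a sum of functions of one coordinate. -/
def IsGood (S : Set (∀ i, X i)) : Prop :=
  ∀ f : S → ℂ, ∃ u : ∀ i, X i → ℂ, IsSolution S f u

/-- `S` is full: it is a maximal good subset of the product of its own projections. -/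
def IsFull (S : Set (∀ i, X i)) : Prop :=
  Maximal (fun T : Set (∀ i, X i) => IsGood T ∧ T ⊆ Set.univ.pi (proj S)) S

/-- `B` is a boundary set of the good set `S`. The union of the projections of `S` is taken as a
disjoint union, so a boundary point is a coordinate index together with a value there. A solution
matters only on the projections of `S`, hence the form of the uniqueness clause. -/
def IsBoundary (S : Set (∀ i, X i)) (B : Set (Σ i, X i)) : Prop :=
  IsGood S ∧ (∀ b ∈ B, b.2 ∈ proj S b.1) ∧
    ∀ (U : B → ℂ) (f : S → ℂ),
      (∃ u : ∀ i, X i → ℂ, IsSolution S f u ∧ ∀ b : B, u b.1.1 b.1.2 = U b) ∧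
      ∀ u v : ∀ i, X i → ℂ,
        (IsSolution S f u ∧ ∀ b : B, u b.1.1 b.1.2 = U b) →
        (IsSolution S f v ∧ ∀ b : B, v b.1.1 b.1.2 = U b) →
        ∀ i, Set.EqOn (u i) (v i) (proj S i)

/-- Two points are related in `S`: some finite full subset of `S` contains both. -/
def Related (S : Set (∀ i, X i)) (p q : ∀ i, X i) : Prop :=
  ∃ F ⊆ S, F.Finite ∧ IsFull F ∧ p ∈ F ∧ q ∈ F

/-- `S` is a related set: a good set any two points of which are related in it. -/
def IsRelatedSet (S : Set (∀ i, X i)) : Prop :=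
  IsGood S ∧ ∀ p ∈ S, ∀ q ∈ S, Related S p q

/-- `G` is the geodesic between `p` and `q` in `S`: the smallest related subset of `S` that
contains both points. Its length is its number of points. -/
def IsGeodesic (S : Set (∀ i, X i)) (p q : ∀ i, X i) (G : Set (∀ i, X i)) : Prop :=
  IsLeast {K : Set (∀ i, X i) | K ⊆ S ∧ IsRelatedSet K ∧ p ∈ K ∧ q ∈ K} G

/-- There is no upper bound for the lengths of geodesics in `S`. -/
def HasUnboundedGeodesics (S : Set (∀ i, X i)) : Prop :=
  ∀ N : ℕ, ∃ p ∈ S, ∃ q ∈ S, ∃ G : Set (∀ i, X i),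
    IsGeodesic S p q G ∧ G.Finite ∧ N < G.ncard

/-- Whenever `f` is bounded on `S`, every solution `u₁, …, u_d` is bounded (on the
projections of `S`). -/
def HasBoundedSolutions (S : Set (∀ i, X i)) : Prop :=
  ∀ f : S → ℂ, (∃ M : ℝ, ∀ p : S, ‖f p‖ ≤ M) →
    ∀ u : ∀ i, X i → ℂ, IsSolution S f u →
      ∀ i, ∃ M : ℝ, ∀ t ∈ proj S i, ‖u i t‖ ≤ M

end General

/-- The symbols: `x i` for `i = 0, 1, 2, 3` is the symbol written `x₁, x₂, x₃, x₄`, and `α j`,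
used for `j ≥ 1`, is the symbol `α_j`. -/
inductive Symb : Type
  | x : Fin 4 → Symb
  | α : ℕ → Symb
  deriving DecidableEq

open Symb

/-- The point `y_k` of the fourfold product, `k ≥ 1`. -/
def y (k : ℕ) : Fin 4 → Symb :=
  if k = 1 then ![x 0, x 1, x 2, x 3]
  else if k = 2 then ![x 0, x 1, α 1, α 2]
  else if k % 4 = 1 then ![x 0, α (k - 1), α k, α (k + 1)]
  else if k % 4 = 2 then ![α (k - 3), x 1, α (k - 1), α k]
  else if k % 4 = 3 then ![α k, α (k + 1), x 2, α (k - 1)]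
  else ![α (k - 1), α k, α (k - 3), x 3]

/-- The point `z = (α_{4n-1}, x₂, α_{4n-3}, x₄)`, `n ≥ 1`. -/
def z (n : ℕ) : Fin 4 → Symb :=
  ![α (4 * n - 1), x 1, α (4 * n - 3), x 3]

/-- The set `S_{4n} ∪ {z}`, where `S_m = {y_1, …, y_m}`. -/
def Sz (n : ℕ) : Set (Fin 4 → Symb) :=
  y '' Set.Icc 1 (4 * n) ∪ {z n}

/-- The set of the three symbols `x₁, x₂, x₃`, which sit in the coordinates 1, 2, 3. -/
def x123 : Set (Σ _ : Fin 4, Symb) :=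
  {⟨0, x 0⟩, ⟨1, x 1⟩, ⟨2, x 2⟩}

/-- The matrix `A_{4n}`: its rows correspond to `y_2, …, y_{4n}, z` and its columns to
`α_1, …, α_{4n}`; an entry is `1` if the symbol occurs in the point and `0` otherwise. -/
def A (n : ℕ) : Matrix (Fin (4 * n)) (Fin (4 * n)) ℝ :=
  fun i j =>
    if ∃ c : Fin 4, (if i.1 + 1 = 4 * n then z n else y (i.1 + 2)) c = α (j.1 + 1) then 1 else 0

end GoodSets

namespace GoodSets

open Symb Finset

/-! ### Fullness and the kernel of the homogeneous equation -/

section General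

variable {d : ℕ} {X : Fin d → Type*}

/-! A nonempty good set is full exactly when the solutions of the homogeneous equation are constant
on each projection (`IsGood.isFull`, `IsFull.hasConstantKernel`), so fullness becomes linear
algebra.

Normalise a solution to vanish at the symbols of `y_1`. Up to `z`, the points link the pair sums `P
= α_{4m+1} + α_{4m+2}` and `R = α_{4m+3} + α_{4m+4}` in a chain: two row sums determine the next
pair sum as half of (their sum minus the previous one). Halving keeps the bound `2M` stable along
the chain, so every value is at most `3M` (`norm_le_of_rowSum_le`). With `M = 0` this gives
invertibility and the constant kernel; for general `M`, the bound on the inverse and bounded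
solutions.

The same elimination gives a linear relation with all coefficients nonzero
(`sum_weight_mul_rowSum`). Hence no point can be dropped from a full subset containing `y_1` and
`y_{4n}` (`block_subset_of_isFull`): the geodesic is the whole block.

For the second claim, blocks of all sizes are glued along the `x_i` and padded with constant
coordinates. Geodesics inside the blocks have unbounded length, while the estimate is uniform in the
block. -/

theorem isGood_iff {S : Set (∀ i, X i)} :
    IsGood S ↔ ∀ f : (∀ i, X i) → ℂ, ∃ u : ∀ i, X i → ℂ, ∀ p ∈ S, f p = ∑ i, u i (p i) := by
  constructor
  · intro h f
    obtain ⟨u, hu⟩ := h fun p => f p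
    exact ⟨u, fun p hp => hu ⟨p, hp⟩⟩
  · intro h f
    obtain ⟨u, hu⟩ := h (Function.extend Subtype.val f 0)
    refine ⟨u, fun p => ?_⟩
    rw [← hu p p.2, Subtype.val_injective.extend_apply]

/-- Solutions of the homogeneous equation on `S` are constant on each projection. -/
def HasConstantKernel (S : Set (∀ i, X i)) : Prop :=
  ∀ u : ∀ i, X i → ℂ, (∀ p ∈ S, ∑ i, u i (p i) = 0) →
    ∀ i, ∀ p ∈ S, ∀ q ∈ S, u i (p i) = u i (q i)

/-- If a larger good set had an extra point `q`, solving for the indicator of `q` would give a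
homogeneous solution on `S`. Its components are constant on the projections, so its sum at `q` would
be 0 instead of 1. -/
theorem IsGood.isFull {S : Set (∀ i, X i)} (hS : IsGood S) (hne : S.Nonempty)
    (h : HasConstantKernel S) : IsFull S := by
  classical
  refine ⟨⟨hS, fun p hp i _ => ⟨p, hp, rfl⟩⟩, ?_⟩
  rintro T ⟨hT, hTS⟩ hST q hq
  by_contra hqS
  obtain ⟨u, hu⟩ := isGood_iff.1 hT fun p => if p = q then 1 else 0
  have hu0 : ∀ p ∈ S, ∑ i, u i (p i) = 0 := fun p hp => by
    rw [← hu p (hST hp), if_neg]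
    rintro rfl
    exact hqS hp
  obtain ⟨p, hp⟩ := hne
  have hpq : ∑ i, u i (q i) = ∑ i, u i (p i) := by
    refine Finset.sum_congr rfl fun i _ => ?_
    obtain ⟨r, hr, hri⟩ := hTS hq i trivial
    have hri' : r i = q i := hri
    rw [← hri']
    exact h u hu0 i r hr p hp
  rw [hu0 p hp, ← hu q hq] at hpq
  simp at hpq

theorem IsFull.isGood {S : Set (∀ i, X i)} (hS : IsFull S) : IsGood S := hS.1.1

/-- If a homogeneous solution takes different values at `p i` and `q i`, exchanging that coordinate
of `p` gives a point `r` where its sum is nonzero. A multiple of it then corrects any solution at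
`r`, so `S` together with `r` is still good. -/
theorem IsFull.hasConstantKernel {S : Set (∀ i, X i)} (hS : IsFull S) :
    HasConstantKernel S := by
  classical
  intro u hu i p hp q hq
  by_contra hne
  set r : ∀ i, X i := Function.update p i (q i) with hr
  have hsum : ∑ j, u j (r j) = u i (q i) - u i (p i) := by
    have h0 := hu p hp
    rw [← Finset.add_sum_erase _ _ (Finset.mem_univ i)] at h0 ⊢
    have h1 : ∑ j ∈ univ.erase i, u j (r j) = ∑ j ∈ univ.erase i, u j (p j) :=
      Finset.sum_congr rfl fun j hj => by
        rw [hr, Function.update_of_ne (Finset.ne_of_mem_erase hj)]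
    rw [h1, hr, Function.update_self]
    linear_combination h0
  have hsum0 : ∑ j, u j (r j) ≠ 0 := by
    rw [hsum]
    exact sub_ne_zero.2 (Ne.symm hne)
  have hrS : r ∉ S := fun h => hsum0 (hu r h)
  refine hrS (hS.2 (y := insert r S) ⟨?_, ?_⟩ (Set.subset_insert r S) (Set.mem_insert r S))
  · rw [isGood_iff]
    intro f
    obtain ⟨v, hv⟩ := isGood_iff.1 hS.isGood f
    set a := (f r - ∑ j, v j (r j)) / ∑ j, u j (r j) with ha
    refine ⟨fun j t => v j t + a * u j t, fun s hs => ?_⟩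
    rw [Finset.sum_add_distrib, ← Finset.mul_sum]
    rcases hs with rfl | hs
    · rw [ha, div_mul_cancel₀ _ hsum0]
      ring
    · rw [hu s hs, hv s hs]
      ring
  · rintro s (rfl | hs) j -
    · by_cases hj : j = i
      · subst hj
        exact ⟨q, hq, by simp [hr]⟩
      · exact ⟨p, hp, by simp [hr, hj]⟩
    · exact ⟨s, hs, rfl⟩

end General

/-! ### The points `y_k` and `z_n` -/

theorem y_one : y 1 = ![x 0, x 1, x 2, x 3] := rfl

theorem y_two : y 2 = ![x 0, x 1, α 1, α 2] := rfl

theorem y_four_mul_add_three (m : ℕ) :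
    y (4 * m + 3) = ![α (4 * m + 3), α (4 * m + 4), x 2, α (4 * m + 2)] := by
  rw [y, if_neg (by omega), if_neg (by omega), if_neg (by omega), if_neg (by omega),
    if_pos (by omega)]
  rfl

theorem y_four_mul_add_four (m : ℕ) :
    y (4 * m + 4) = ![α (4 * m + 3), α (4 * m + 4), α (4 * m + 1), x 3] := by
  rw [y, if_neg (by omega), if_neg (by omega), if_neg (by omega), if_neg (by omega),
    if_neg (by omega)]
  rfl

theorem y_four_mul_add_five (m : ℕ) :
    y (4 * m + 5) = ![x 0, α (4 * m + 4), α (4 * m + 5), α (4 * m + 6)] := by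
  rw [y, if_neg (by omega), if_neg (by omega), if_pos (by omega)]
  rfl

theorem y_four_mul_add_six (m : ℕ) :
    y (4 * m + 6) = ![α (4 * m + 3), x 1, α (4 * m + 5), α (4 * m + 6)] := by
  rw [y, if_neg (by omega), if_neg (by omega), if_neg (by omega), if_pos (by omega)]
  rfl

theorem z_add_one (m : ℕ) : z (m + 1) = ![α (4 * m + 3), x 1, α (4 * m + 1), x 3] := rfl

/-- Every `k ≥ 1` is of one of the six forms in which `y k` is known explicitly. -/
theorem index_cases {k : ℕ} (hk : 1 ≤ k) : k = 1 ∨ k = 2 ∨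
    ∃ m, k = 4 * m + 3 ∨ k = 4 * m + 4 ∨ k = 4 * m + 5 ∨ k = 4 * m + 6 := by
  by_cases h : k ≤ 2
  · omega
  · exact Or.inr (Or.inr ⟨(k - 3) / 4, by omega⟩)

theorem y_injOn : Set.InjOn y (Set.Ici 1) := by
  intro k hk l hl h
  rcases index_cases hk with rfl | rfl | ⟨m, rfl | rfl | rfl | rfl⟩ <;>
  rcases index_cases hl with rfl | rfl | ⟨m', rfl | rfl | rfl | rfl⟩ <;>
  simp only [y_one, y_two, y_four_mul_add_three, y_four_mul_add_four, y_four_mul_add_five,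
    y_four_mul_add_six, Matrix.vecCons_inj, α.injEq, reduceCtorEq, false_and,
    and_false] at h <;> omega

/-- The coordinate in which a symbol occurs. -/
def col : Symb → Fin 4
  | x i => i
  | α j => Fin.ofNat 4 (j + 1)

theorem col_α (j : ℕ) : (col (α j) : ℕ) = (j + 1) % 4 := rfl

/-- No symbol occurs in two different coordinates, so a tuple of functions can be treated as a
single function on symbols. -/
theorem col_y {k : ℕ} (hk : 1 ≤ k) (c : Fin 4) : col (y k c) = c := by
  rcases index_cases hk with rfl | rfl | ⟨m, rfl | rfl | rfl | rfl⟩ <;>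
  fin_cases c <;>
  simp [y_one, y_two, y_four_mul_add_three, y_four_mul_add_four, y_four_mul_add_five,
    y_four_mul_add_six] <;>
  first | rfl | exact Fin.ext (by rw [col_α]; simp; omega)

theorem col_z {n : ℕ} (hn : 1 ≤ n) (c : Fin 4) : col (z n c) = c := by
  obtain ⟨m, rfl⟩ := Nat.exists_eq_add_of_le' hn
  fin_cases c <;> simp [z_add_one] <;>
    first | rfl | exact Fin.ext (by rw [col_α]; simp; omega)

theorem y_index {n k j : ℕ} (hk : 1 ≤ k) (hkn : k ≤ 4 * n) {c : Fin 4} (h : y k c = α j) :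
    1 ≤ j ∧ j ≤ 4 * n := by
  rcases index_cases hk with rfl | rfl | ⟨m, rfl | rfl | rfl | rfl⟩ <;>
  fin_cases c <;>
  simp [y_one, y_two, y_four_mul_add_three, y_four_mul_add_four, y_four_mul_add_five,
    y_four_mul_add_six] at h <;> omega

theorem z_index {n j : ℕ} (hn : 1 ≤ n) {c : Fin 4} (h : z n c = α j) : 1 ≤ j ∧ j ≤ 4 * n := by
  obtain ⟨m, rfl⟩ := Nat.exists_eq_add_of_le' hn
  fin_cases c <;> simp [z_add_one] at h <;> omega

theorem y_mem_Sz {n k : ℕ} (hk : 1 ≤ k) (hkn : k ≤ 4 * n) : y k ∈ Sz n :=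
  Or.inl ⟨k, ⟨hk, hkn⟩, rfl⟩

theorem z_mem_Sz (n : ℕ) : z n ∈ Sz n := Or.inr rfl

theorem Sz_finite (n : ℕ) : (Sz n).Finite :=
  ((Set.finite_Icc _ _).image _).union (Set.finite_singleton _)

theorem col_of_mem_Sz {n : ℕ} (hn : 1 ≤ n) {p : Fin 4 → Symb} (hp : p ∈ Sz n) (c : Fin 4) :
    col (p c) = c := by
  rcases hp with ⟨k, hk, rfl⟩ | rfl
  exacts [col_y hk.1 c, col_z hn c]

theorem index_of_mem_Sz {n j : ℕ} (hn : 1 ≤ n) {p : Fin 4 → Symb} (hp : p ∈ Sz n) {c : Fin 4}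
    (h : p c = α j) : 1 ≤ j ∧ j ≤ 4 * n := by
  rcases hp with ⟨k, hk, rfl⟩ | rfl
  exacts [y_index hk.1 hk.2 h, z_index hn h]

/-! ### Estimates for one block -/

section Estimate

variable {𝕜 : Type*} [RCLike 𝕜]

/-- The sum of the values of `w` at the four symbols of a point. -/
def rowSum (w : Symb → 𝕜) (p : Fin 4 → Symb) : 𝕜 := ∑ c, w (p c)

theorem norm_le_of_two_mul {a : 𝕜} {M : ℝ} (h : ‖2 * a‖ ≤ 2 * M) : ‖a‖ ≤ M := by
  rw [norm_mul, RCLike.norm_ofNat] at h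
  linarith

theorem norm_add_sub_le {a b c : 𝕜} {A B C : ℝ} (ha : ‖a‖ ≤ A) (hb : ‖b‖ ≤ B) (hc : ‖c‖ ≤ C) :
    ‖a + b - c‖ ≤ A + B + C :=
  (norm_sub_le _ _).trans (add_le_add ((norm_add_le _ _).trans (add_le_add ha hb)) hc)

/-- The values of `w` at the symbols `α_j` are bounded by three times the sums over the points. -/
theorem norm_le_of_rowSum_le {n : ℕ} {w : Symb → 𝕜} {M : ℝ} (hx : ∀ i, w (x i) = 0)
    (hw : ∀ p ∈ Sz n, ‖rowSum w p‖ ≤ M) {j : ℕ} (hj : 1 ≤ j) (hjn : j ≤ 4 * n) :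
    ‖w (α j)‖ ≤ 3 * M := by
  have hy : ∀ k, 1 ≤ k → k ≤ 4 * n → ‖rowSum w (y k)‖ ≤ M := fun k h1 h2 =>
    hw _ (y_mem_Sz h1 h2)
  have hz := hw _ (z_mem_Sz n)
  have hM : 0 ≤ M := (norm_nonneg _).trans hz
  have h2 := hy 2 (by omega) (by omega)
  have hq : ∀ m < n, ‖w (α (4 * m + 3)) + w (α (4 * m + 4)) + w (α (4 * m + 2))‖ ≤ M := by
    intro m hm
    simpa [rowSum, Fin.sum_univ_four, y_four_mul_add_three, hx] using
      hy (4 * m + 3) (by omega) (by omega)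
  have hp : ∀ m < n, ‖w (α (4 * m + 3)) + w (α (4 * m + 4)) + w (α (4 * m + 1))‖ ≤ M := by
    intro m hm
    simpa [rowSum, Fin.sum_univ_four, y_four_mul_add_four, hx] using
      hy (4 * m + 4) (by omega) (by omega)
  have hs : ∀ m, m + 1 < n →
      ‖w (α (4 * m + 4)) + w (α (4 * m + 5)) + w (α (4 * m + 6))‖ ≤ M := by
    intro m hm
    simpa [rowSum, Fin.sum_univ_four, y_four_mul_add_five, hx] using
      hy (4 * m + 5) (by omega) (by omega)
  have hr : ∀ m, m + 1 < n →
      ‖w (α (4 * m + 3)) + w (α (4 * m + 5)) + w (α (4 * m + 6))‖ ≤ M := by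
    intro m hm
    simpa [rowSum, Fin.sum_univ_four, y_four_mul_add_six, hx] using
      hy (4 * m + 6) (by omega) (by omega)
  simp only [rowSum, y_two, Fin.sum_univ_four, Matrix.cons_val, hx, zero_add] at h2
  -- The two rows add up to `2R + P`, so `‖2R‖ ≤ M + M + 2M`: the bound `2M` reproduces itself.
  have hRP : ∀ m < n, ‖w (α (4 * m + 1)) + w (α (4 * m + 2))‖ ≤ 2 * M →
      ‖w (α (4 * m + 3)) + w (α (4 * m + 4))‖ ≤ 2 * M := by
    intro m hm h
    refine norm_le_of_two_mul ?_
    have := norm_add_sub_le (hq m hm) (hp m hm) h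
    calc _ = _ := by congr 1; ring
      _ ≤ _ := this
      _ = _ := by ring
  have hP : ∀ m < n, ‖w (α (4 * m + 1)) + w (α (4 * m + 2))‖ ≤ 2 * M := by
    intro m
    induction m with
    | zero => intro _; simpa using h2.trans (by linarith)
    | succ m ih =>
      intro hm
      refine norm_le_of_two_mul ?_
      have := norm_add_sub_le (hs m hm) (hr m hm) (hRP m (by omega) (ih (by omega)))
      calc _ = _ := by congr 1; simp only [mul_add, add_assoc]; ring
        _ ≤ _ := this
        _ = _ := by ring
  -- The rows `p` and `q` differ by `α_{4m+1} - α_{4m+2}`; together with the pair sum this separates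
  -- the two values.
  have hp' : ∀ m < n, ‖w (α (4 * m + 1))‖ ≤ 2 * M := by
    intro m hm
    refine norm_le_of_two_mul ?_
    have := norm_add_sub_le (hP m hm) (hp m hm) (hq m hm)
    calc _ = _ := by congr 1; ring
      _ ≤ _ := this
      _ = _ := by ring
  have hq' : ∀ m < n, ‖w (α (4 * m + 2))‖ ≤ 2 * M := by
    intro m hm
    refine norm_le_of_two_mul ?_
    have := norm_add_sub_le (hP m hm) (hq m hm) (hp m hm)
    calc _ = _ := by congr 1; ring
      _ ≤ _ := this
      _ = _ := by ring
  have hr' : ∀ m < n, ‖w (α (4 * m + 3))‖ ≤ 3 * M := by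
    intro m hm
    by_cases hm' : m + 1 < n
    · refine (norm_le_of_two_mul (M := 2 * M) ?_).trans (by linarith)
      have := norm_add_sub_le (hRP m hm (hP m hm)) (hr m hm') (hs m hm')
      calc _ = _ := by congr 1; ring
        _ ≤ _ := this
        _ = _ := by ring
    -- The last block has no successor rows; `z` replaces them. Only here is the constant 3 attained
    -- instead of 2.
    · obtain rfl : n = m + 1 := by omega
      simp only [rowSum, z_add_one, Fin.sum_univ_four, Matrix.cons_val, hx, add_zero] at hz
      have := (norm_sub_le _ _).trans (add_le_add hz (hp' m hm))
      calc _ = _ := by congr 1; ring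
        _ ≤ _ := this
        _ = _ := by ring
  have hs' : ∀ m < n, ‖w (α (4 * m + 4))‖ ≤ 3 * M := by
    intro m hm
    by_cases hm' : m + 1 < n
    · refine (norm_le_of_two_mul (M := 2 * M) ?_).trans (by linarith)
      have := norm_add_sub_le (hRP m hm (hP m hm)) (hs m hm') (hr m hm')
      calc _ = _ := by congr 1; ring
        _ ≤ _ := this
        _ = _ := by ring
    · obtain rfl : n = m + 1 := by omega
      simp only [rowSum, z_add_one, Fin.sum_univ_four, Matrix.cons_val, hx, add_zero] at hz
      have := (norm_sub_le _ _).trans (add_le_add (hp m hm) hz)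
      calc _ = _ := by congr 1; ring
        _ ≤ _ := this
        _ ≤ _ := by linarith
  obtain ⟨m, rfl | rfl | rfl | rfl⟩ :
      ∃ m, j = 4 * m + 1 ∨ j = 4 * m + 2 ∨ j = 4 * m + 3 ∨ j = 4 * m + 4 :=
    ⟨(j - 1) / 4, by omega⟩
  · exact (hp' m (by omega)).trans (by linarith)
  · exact (hq' m (by omega)).trans (by linarith)
  · exact hr' m (by omega)
  · exact hs' m (by omega)

/-! ### The matrix `A_{4n}` -/

/-- The point which corresponds to a row of `A n`. -/
def rowPoint (n : ℕ) (i : Fin (4 * n)) : Fin 4 → Symb :=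
  if i.1 + 1 = 4 * n then z n else y (i.1 + 2)

theorem rowPoint_mem (n : ℕ) (i : Fin (4 * n)) : rowPoint n i ∈ Sz n := by
  unfold rowPoint
  split_ifs with h
  · exact z_mem_Sz n
  · exact y_mem_Sz (by omega) (by omega)

/-- Every point of `S_{4n} ∪ {z}` except `y_1` corresponds to a row of `A n`. -/
theorem exists_rowPoint {n : ℕ} (hn : 1 ≤ n) {p : Fin 4 → Symb} (hp : p ∈ Sz n) :
    p = y 1 ∨ ∃ i, rowPoint n i = p := by
  rcases hp with ⟨k, ⟨hk, hkn⟩, rfl⟩ | rfl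
  · rcases hk.eq_or_lt with rfl | hk
    · exact Or.inl rfl
    · refine Or.inr ⟨⟨k - 2, by omega⟩, ?_⟩
      rw [rowPoint, if_neg (by simp only; omega)]
      congr 1
      simp only
      omega
  · refine Or.inr ⟨⟨4 * n - 1, by omega⟩, ?_⟩
    rw [rowPoint, if_pos (by simp only; omega)]

/-- The function on symbols which vanishes at `x_1, …, x_4` and has the value `v_j` at `α_{j+1}`. -/
def ofVec {n : ℕ} (v : Fin (4 * n) → 𝕜) : Symb → 𝕜
  | x _ => 0
  | α j => if h : 1 ≤ j ∧ j ≤ 4 * n then v ⟨j - 1, by omega⟩ else 0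

@[simp] theorem ofVec_x {n : ℕ} (v : Fin (4 * n) → 𝕜) (i : Fin 4) : ofVec v (x i) = 0 := rfl

@[simp] theorem ofVec_α {n : ℕ} (v : Fin (4 * n) → 𝕜) (j : Fin (4 * n)) :
    ofVec v (α (j + 1)) = v j := by
  have : 1 ≤ j.1 + 1 ∧ j.1 + 1 ≤ 4 * n := by omega
  simp [ofVec, this]

theorem rowSum_ofVec {n : ℕ} (hn : 1 ≤ n) (v : Fin (4 * n) → 𝕜) (i : Fin (4 * n)) :
    rowSum (ofVec v) (rowPoint n i) = ∑ j, ((A n i j : ℝ) : 𝕜) * v j := by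
  have hp := rowPoint_mem n i
  -- A symbol occurs in at most one coordinate of a point, so the existential in the entry is a sum
  -- of indicators.
  have hA : ∀ j, ((A n i j : ℝ) : 𝕜) =
      ∑ c, if rowPoint n i c = α (j.1 + 1) then (1 : 𝕜) else 0 := by
    intro j
    change (((if ∃ c, rowPoint n i c = α (j.1 + 1) then 1 else 0 : ℝ)) : 𝕜) = _
    split_ifs with h
    · obtain ⟨c, hc⟩ := h
      rw [Finset.sum_eq_single c]
      · simp [hc]
      · intro b _ hb
        rw [if_neg]
        intro h'
        apply hb
        rw [← col_of_mem_Sz hn hp b, ← col_of_mem_Sz hn hp c, h', hc]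
      · simp
    · push Not at h
      simp [h]
  simp only [hA, Finset.sum_mul, rowSum]
  rw [Finset.sum_comm]
  refine Finset.sum_congr rfl fun c _ => ?_
  cases hc : rowPoint n i c with
  | x a => simp
  | α l =>
    obtain ⟨h1, h2⟩ := index_of_mem_Sz hn hp hc
    rw [Finset.sum_eq_single ⟨l - 1, by omega⟩]
    · simp [ofVec, h1, h2]
    · intro j _ hj
      rw [if_neg, zero_mul]
      intro h
      apply hj
      simp only [α.injEq] at h
      ext
      simp only
      omega
    · simp

theorem rowSum_ofVec_y_one {n : ℕ} (v : Fin (4 * n) → 𝕜) : rowSum (ofVec v) (y 1) = 0 := by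
  simp [rowSum, y_one, Fin.sum_univ_four]

theorem abs_le_of_mulVec_le {n : ℕ} (hn : 1 ≤ n) (v : Fin (4 * n) → ℝ) {M : ℝ} (hM : 0 ≤ M)
    (h : ∀ i, |(A n).mulVec v i| ≤ M) (i : Fin (4 * n)) : |v i| ≤ 3 * M := by
  have := norm_le_of_rowSum_le (w := ofVec v) (n := n) (M := M) (fun _ => rfl) (fun p hp => ?_)
    (j := i + 1) (by omega) (by omega)
  · simpa using this
  · rcases exists_rowPoint hn hp with rfl | ⟨k, rfl⟩
    · simpa [rowSum_ofVec_y_one] using hM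
    · rw [rowSum_ofVec hn]
      exact h k

/-- The estimate with bound 0 makes the kernel trivial. -/
theorem isUnit_A {n : ℕ} (hn : 1 ≤ n) : IsUnit (A n) := by
  rw [← Matrix.mulVec_injective_iff_isUnit]
  intro v w hvw
  rw [← sub_eq_zero]
  ext i
  have := abs_le_of_mulVec_le hn (v - w) le_rfl
    (fun k => by rw [Matrix.mulVec_sub, hvw, sub_self]; simp) i
  simpa using this

theorem sum_abs_inv_A_le {n : ℕ} (hn : 1 ≤ n) (i : Fin (4 * n)) :
    ∑ j, |(A n)⁻¹ i j| ≤ 3 := by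
  -- Testing the sup-norm bound on the sign vector of row `i` turns the `i`-th entry of the product
  -- into the absolute row sum.
  set s : Fin (4 * n) → ℝ := fun j => SignType.sign ((A n)⁻¹ i j) with hs
  have hsign : ∀ a : SignType, |(a : ℝ)| ≤ 1 := fun a => by cases a <;> simp
  have hdet := (Matrix.isUnit_iff_isUnit_det _).1 (isUnit_A hn)
  have h := abs_le_of_mulVec_le hn ((A n)⁻¹.mulVec s) zero_le_one (fun k => by
    rw [Matrix.mulVec_mulVec, Matrix.mul_nonsing_inv _ hdet, Matrix.one_mulVec]
    exact hsign _) i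
  rw [mul_one] at h
  refine le_trans (le_of_eq ?_) ((le_abs_self _).trans h)
  rw [Matrix.mulVec, dotProduct]
  exact Finset.sum_congr rfl fun j _ => (self_mul_sign _).symm

theorem exists_rowSum_eq {n : ℕ} (hn : 1 ≤ n) (f : (Fin 4 → Symb) → ℂ) (hf : f (y 1) = 0) :
    ∃ w : Symb → ℂ, (∀ i, w (x i) = 0) ∧ ∀ p ∈ Sz n, rowSum w p = f p := by
  set B : Matrix (Fin (4 * n)) (Fin (4 * n)) ℂ := (A n).map Complex.ofRealHom with hB
  have hdet : IsUnit B.det :=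
    (Matrix.isUnit_iff_isUnit_det _).1 ((isUnit_A hn).map (RingHom.mapMatrix Complex.ofRealHom))
  refine ⟨ofVec (B⁻¹.mulVec fun i => f (rowPoint n i)), fun _ => rfl, fun p hp => ?_⟩
  rcases exists_rowPoint hn hp with rfl | ⟨i, rfl⟩
  · rw [rowSum_ofVec_y_one, hf]
  · rw [rowSum_ofVec hn]
    change B.mulVec _ i = _
    rw [Matrix.mulVec_mulVec, Matrix.mul_nonsing_inv _ hdet, Matrix.one_mulVec]

end Estimate

/-! ### The linear relation between the sums over `y_2, …, y_{4n}` -/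

/-- The coefficients of the relation. -/
def weight (k : ℕ) : ℂ :=
  if k = 2 then 1
  else if k % 4 = 3 ∨ k % 4 = 0 then -4 ^ ((k - 3) / 4)
  else 2 * 4 ^ ((k - 5) / 4)

theorem weight_ne_zero (k : ℕ) : weight k ≠ 0 := by
  unfold weight
  split_ifs <;> simp

/-- The weights come from eliminating the pair sums along the chain: `P - (2R + P) = -2R`, then `-2R
+ 2(R + 2P') = 4P'`, where `P'` is the next `P`. Each block thus multiplies the coefficients by 4.
-/
theorem sum_weight_mul_rowSum {w : Symb → ℂ} (hx : ∀ i, w (x i) = 0) (m : ℕ) :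
    ∑ k ∈ Icc 2 (4 * m + 4), weight k * rowSum w (y k) =
      -2 * 4 ^ m * (w (α (4 * m + 3)) + w (α (4 * m + 4))) := by
  have h3 : ∀ m, weight (4 * m + 3) = -4 ^ m := fun m => by
    rw [weight, if_neg (by omega), if_pos (by omega)]
    congr 2; omega
  have h4 : ∀ m, weight (4 * m + 4) = -4 ^ m := fun m => by
    rw [weight, if_neg (by omega), if_pos (by omega)]
    congr 2; omega
  have h5 : ∀ m, weight (4 * m + 5) = 2 * 4 ^ m := fun m => by
    rw [weight, if_neg (by omega), if_neg (by omega)]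
    congr 2; omega
  have h6 : ∀ m, weight (4 * m + 6) = 2 * 4 ^ m := fun m => by
    rw [weight, if_neg (by omega), if_neg (by omega)]
    congr 2; omega
  have r3 : ∀ m, rowSum w (y (4 * m + 3)) =
      w (α (4 * m + 3)) + w (α (4 * m + 4)) + w (α (4 * m + 2)) := fun m => by
    simp [rowSum, Fin.sum_univ_four, y_four_mul_add_three, hx]
  have r4 : ∀ m, rowSum w (y (4 * m + 4)) =
      w (α (4 * m + 3)) + w (α (4 * m + 4)) + w (α (4 * m + 1)) := fun m => by
    simp [rowSum, Fin.sum_univ_four, y_four_mul_add_four, hx]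
  have r5 : ∀ m, rowSum w (y (4 * m + 5)) =
      w (α (4 * m + 4)) + w (α (4 * m + 5)) + w (α (4 * m + 6)) := fun m => by
    simp [rowSum, Fin.sum_univ_four, y_four_mul_add_five, hx]
  have r6 : ∀ m, rowSum w (y (4 * m + 6)) =
      w (α (4 * m + 3)) + w (α (4 * m + 5)) + w (α (4 * m + 6)) := fun m => by
    simp [rowSum, Fin.sum_univ_four, y_four_mul_add_six, hx]
  induction m with
  | zero =>
    have e3 := h3 0
    have e4 := h4 0
    have q3 := r3 0
    have q4 := r4 0
    have q2 : rowSum w (y 2) = w (α 1) + w (α 2) := by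
      simp [rowSum, Fin.sum_univ_four, y_two, hx]
    have e2 : weight 2 = 1 := rfl
    simp only [mul_zero, zero_add, pow_zero] at e3 e4 q3 q4 ⊢
    rw [Finset.sum_Icc_succ_top (by norm_num), Finset.sum_Icc_succ_top (by norm_num),
      Finset.Icc_self, Finset.sum_singleton]
    simp only [Nat.reduceAdd, e2, e3, e4, q2, q3, q4]
    ring
  | succ m ih =>
    have e3 := h3 (m + 1)
    have e4 := h4 (m + 1)
    have q3 := r3 (m + 1)
    have q4 := r4 (m + 1)
    simp only [mul_add, mul_one, add_assoc, Nat.reduceAdd] at e3 e4 q3 q4 ih ⊢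
    rw [Finset.sum_Icc_succ_top (by omega), Finset.sum_Icc_succ_top (by omega),
      Finset.sum_Icc_succ_top (by omega), Finset.sum_Icc_succ_top (by omega), ih]
    simp only [add_assoc, Nat.reduceAdd, h5, h6, e3, e4, r5, r6, q3, q4]
    ring

/-- If `w` vanishes at the symbols of `y_1` and `y_{4n}`, then the sum over the points cannot be
the indicator function of a single point of `S_{4n} ∪ {z}`. -/
theorem not_rowSum_indicator {n : ℕ} (hn : 1 ≤ n) {w : Symb → ℂ} (hx : ∀ i, w (x i) = 0)
    (hy : ∀ c, w (y (4 * n) c) = 0) {r : Fin 4 → Symb} (hr : r ∈ Sz n)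
    (hw : ∀ p ∈ Sz n, rowSum w p = if p = r then 1 else 0) : False := by
  obtain ⟨m, rfl⟩ := Nat.exists_eq_add_of_le' hn
  rw [mul_add, mul_one, y_four_mul_add_four] at hy
  have a3 : w (α (4 * m + 3)) = 0 := hy 0
  have a4 : w (α (4 * m + 4)) = 0 := hy 1
  have a1 : w (α (4 * m + 1)) = 0 := hy 2
  rcases hr with ⟨k, ⟨hk, hkn⟩, rfl⟩ | rfl
  · rcases hk.eq_or_lt with rfl | hk
    · have := hw (y 1) (y_mem_Sz le_rfl (by omega))
      simp [rowSum, y_one, Fin.sum_univ_four, hx] at this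
    -- Only the term of `y k` survives on the left, with nonzero weight, while the right side
    -- vanishes because `α_{4m+3}` and `α_{4m+4}` occur in `y_{4n}`.
    · have h := sum_weight_mul_rowSum hx m
      rw [Finset.sum_eq_single k] at h
      · rw [hw _ (y_mem_Sz hk.le hkn), a3, a4] at h
        simp [weight_ne_zero] at h
      · intro l hl hlk
        rw [Finset.mem_Icc] at hl
        rw [hw _ (y_mem_Sz (by omega) (by omega)), if_neg, mul_zero]
        intro h'
        refine hlk (y_injOn ?_ ?_ h')
        · simp only [Set.mem_Ici]; omega
        · exact hk.le
      · intro h'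
        exact absurd (Finset.mem_Icc.2 ⟨hk, by omega⟩) h'
  · have := hw _ (z_mem_Sz (m + 1))
    simp [rowSum, z_add_one, Fin.sum_univ_four, hx, a3, a1] at this


/-! ### Bouquets of relabelled blocks -/

section Bouquet

variable {k : ℕ}

/-- Rename the symbols `α_j`. -/
def relabel (g : ℕ → ℕ) : Symb → Symb
  | x i => x i
  | α j => α (g j)

/-- Append `k` constant coordinates to a point of the fourfold product, after renaming. -/
def place (k : ℕ) (g : ℕ → ℕ) (p : Fin 4 → Symb) : Fin (4 + k) → Symb :=
  Fin.append (relabel g ∘ p) fun _ => x 0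

/-- The union of copies of the sets `S_{4n} ∪ {z_n}`, `n ∈ N`, in which the symbols `α_j` have been
renamed by `ψ n`, while the symbols `x_i` are common to all copies. -/
def bouquet (k : ℕ) (ψ : ℕ → ℕ → ℕ) (N : Set ℕ) : Set (Fin (4 + k) → Symb) :=
  {P | ∃ n ∈ N, ∃ p ∈ Sz n, place k (ψ n) p = P}

theorem place_mem_bouquet {ψ : ℕ → ℕ → ℕ} {N : Set ℕ} {n : ℕ} (hn : n ∈ N) {p : Fin 4 → Symb}
    (hp : p ∈ Sz n) : place k (ψ n) p ∈ bouquet k ψ N :=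
  ⟨n, hn, p, hp, rfl⟩

theorem bouquet_mono {ψ : ℕ → ℕ → ℕ} {N N' : Set ℕ} (h : N ⊆ N') :
    bouquet k ψ N ⊆ bouquet k ψ N' := by
  rintro _ ⟨n, hn, p, hp, rfl⟩
  exact ⟨n, h hn, p, hp, rfl⟩

theorem bouquet_finite {ψ : ℕ → ℕ → ℕ} {N : Set ℕ} (hN : N.Finite) :
    (bouquet k ψ N).Finite := by
  have : bouquet k ψ N = ⋃ n ∈ N, place k (ψ n) '' Sz n := by
    ext P
    simp [bouquet]
  rw [this]
  exact hN.biUnion fun n _ => (Sz_finite n).image _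

theorem place_zero_id (p : Fin 4 → Symb) : place 0 id p = p := by
  funext c
  rw [place, Fin.append_right_nil _ _ rfl]
  change relabel id (p c) = p c
  cases p c <;> rfl

theorem bouquet_zero_singleton (n : ℕ) : bouquet 0 (fun _ => id) {n} = Sz n := by
  ext P
  simp [bouquet, place_zero_id]

/-- Since `y_1` contains no `α_j`, it is a point common to all blocks and serves as base point. -/
theorem place_y_one (g g' : ℕ → ℕ) : place k g (y 1) = place k g' (y 1) := by
  unfold place
  congr 1
  funext c
  fin_cases c <;> rfl

theorem sum_place (u : Fin (4 + k) → Symb → ℂ) (g : ℕ → ℕ) (p : Fin 4 → Symb) :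
    ∑ i, u i (place k g p i) =
      (∑ c, u (Fin.castAdd k c) (relabel g (p c))) + ∑ i, u (Fin.natAdd 4 i) (x 0) := by
  simp [place, Fin.sum_univ_add]

theorem relabel_injective {g : ℕ → ℕ} (hg : g.Injective) : (relabel g).Injective := by
  rintro (i | i) (j | j) h <;> simp_all [relabel, hg.eq_iff]

theorem place_injective {g : ℕ → ℕ} (hg : g.Injective) : (place k g).Injective := by
  intro p q h
  funext c
  have := congrFun h (Fin.castAdd k c)
  simp only [place, Fin.append_left, Function.comp_apply] at this
  exact relabel_injective hg this

/-- The deviation of a tuple of functions from its values at the point `y_1`, read on the symbols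
of a block. -/
def deviation (u : Fin (4 + k) → Symb → ℂ) (g : ℕ → ℕ) (s : Symb) : ℂ :=
  u (Fin.castAdd k (col s)) (relabel g s) - u (Fin.castAdd k (col s)) (x (col s))

theorem deviation_x (u : Fin (4 + k) → Symb → ℂ) (g : ℕ → ℕ) (i : Fin 4) :
    deviation u g (x i) = 0 := sub_self _

theorem deviation_apply (u : Fin (4 + k) → Symb → ℂ) (g : ℕ → ℕ) {p : Fin 4 → Symb}
    (hp : ∀ c, col (p c) = c) (c : Fin 4) :
    deviation u g (p c) =
      u (Fin.castAdd k c) (place k g p (Fin.castAdd k c)) -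
        u (Fin.castAdd k c) (place k g (y 1) (Fin.castAdd k c)) := by
  have h : y 1 c = x c := by fin_cases c <;> rfl
  simp [deviation, hp, place, h, relabel]

theorem rowSum_deviation (u : Fin (4 + k) → Symb → ℂ) (g : ℕ → ℕ) {p : Fin 4 → Symb}
    (hp : ∀ c, col (p c) = c) :
    rowSum (deviation u g) p =
      ∑ i, u i (place k g p i) - ∑ i, u i (place k g (y 1) i) := by
  simp only [rowSum, deviation_apply u g hp, Finset.sum_sub_distrib, Fin.sum_univ_add]
  simp [place]

variable {ψ : ℕ → ℕ → ℕ} {N : Set ℕ}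

/-- The renamings `ψ n`, `n ∈ N`, are injective and have disjoint ranges. -/
def Separates (ψ : ℕ → ℕ → ℕ) (N : Set ℕ) : Prop :=
  Set.InjOn (fun a : ℕ × ℕ => ψ a.1 a.2) {a | a.1 ∈ N}

theorem Separates.mono {N' : Set ℕ} (hψ : Separates ψ N) (h : N' ⊆ N) : Separates ψ N' :=
  Set.InjOn.mono (fun a (ha : a.1 ∈ N') => h ha) hψ

theorem Separates.injective (hψ : Separates ψ N) {n : ℕ} (hn : n ∈ N) : (ψ n).Injective :=
  fun i j h => congrArg Prod.snd <|
    hψ (show (n, i) ∈ {a : ℕ × ℕ | a.1 ∈ N} from hn)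
      (show (n, j) ∈ {a : ℕ × ℕ | a.1 ∈ N} from hn) h

/-- The deviation from `y_1` has row sums that are differences of two given sums, hence at most
`2M`; the factor 3 of the block estimate gives `6M`. -/
theorem norm_sub_le_of_mem_bouquet (hN : ∀ n ∈ N, 1 ≤ n) {u : Fin (4 + k) → Symb → ℂ} {M : ℝ}
    (hu : ∀ P ∈ bouquet k ψ N, ‖∑ i, u i (P i)‖ ≤ M) {P : Fin (4 + k) → Symb}
    (hP : P ∈ bouquet k ψ N) (i : Fin (4 + k)) :
    ‖u i (P i) - u i (place k id (y 1) i)‖ ≤ 6 * M := by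
  obtain ⟨n, hn, p, hp, rfl⟩ := hP
  have hM : 0 ≤ M := (norm_nonneg _).trans (hu _ (place_mem_bouquet hn hp))
  rw [place_y_one id (ψ n)]
  induction i using Fin.addCases with
  | left c =>
    rw [← deviation_apply u (ψ n) (col_of_mem_Sz (hN n hn) hp)]
    cases hs : p c with
    | x i => simpa [deviation_x] using hM
    | α j =>
      obtain ⟨h1, h2⟩ := index_of_mem_Sz (hN n hn) hp hs
      refine (norm_le_of_rowSum_le (M := 2 * M) (deviation_x u _) (fun q hq => ?_) h1 h2).trans
        (by linarith)
      rw [rowSum_deviation u _ (col_of_mem_Sz (hN n hn) hq), two_mul]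
      have := hN n hn
      exact (norm_sub_le _ _).trans (add_le_add (hu _ (place_mem_bouquet hn hq))
        (hu _ (place_mem_bouquet hn (y_mem_Sz le_rfl (by omega)))))
  | right c => simpa [place] using hM

theorem hasConstantKernel_bouquet (hN : ∀ n ∈ N, 1 ≤ n) :
    HasConstantKernel (bouquet k ψ N) := by
  have key : ∀ u : Fin (4 + k) → Symb → ℂ, (∀ P ∈ bouquet k ψ N, ∑ i, u i (P i) = 0) →
      ∀ i, ∀ P ∈ bouquet k ψ N, u i (P i) = u i (place k id (y 1) i) := by
    intro u hu i P hP
    have := norm_sub_le_of_mem_bouquet (u := u) (M := 0) hN (fun Q hQ => by simp [hu Q hQ]) hP i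
    rw [mul_zero, norm_le_zero_iff] at this
    exact sub_eq_zero.1 this
  intro u hu i P hP Q hQ
  rw [key u hu i P hP, key u hu i Q hQ]

theorem hasBoundedSolutions_bouquet (hN : ∀ n ∈ N, 1 ≤ n) :
    HasBoundedSolutions (bouquet k ψ N) := by
  rintro f ⟨M, hM⟩ u hu i
  refine ⟨6 * M + ‖u i (place k id (y 1) i)‖, ?_⟩
  rintro _ ⟨P, hP, rfl⟩
  have := norm_sub_le_of_mem_bouquet (u := u) hN (fun Q hQ => by
    have h := hM ⟨Q, hQ⟩
    rwa [hu ⟨Q, hQ⟩] at h) hP i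
  exact (norm_le_norm_sub_add _ (u i (place k id (y 1) i))).trans (by simpa using this)

/-- Blocks share only the symbols `x_i`, at which the block solutions vanish, so these solutions
glue together. -/
theorem isGood_bouquet (hN : ∀ n ∈ N, 1 ≤ n) (hψ : Separates ψ N) :
    IsGood (bouquet k ψ N) := by
  classical
  rw [isGood_iff]
  intro f
  have hw : ∀ n, ∃ w : Symb → ℂ, (∀ i, w (x i) = 0) ∧
      (n ∈ N → ∀ p ∈ Sz n, rowSum w p = f (place k (ψ n) p) - f (place k id (y 1))) := by
    intro n
    by_cases hn : n ∈ N
    · obtain ⟨w, h1, h2⟩ := exists_rowSum_eq (hN n hn)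
        (fun p => f (place k (ψ n) p) - f (place k id (y 1)))
        (by rw [place_y_one (ψ n) id, sub_self])
      exact ⟨w, h1, fun _ => h2⟩
    · exact ⟨0, fun _ => rfl, fun h => absurd h hn⟩
  choose w hx hw using hw
  let W : Symb → ℂ := fun
    | x _ => 0
    | α j => Function.extend (fun a : {a : ℕ × ℕ // a.1 ∈ N} => ψ a.1.1 a.1.2)
        (fun a => w a.1.1 (α a.1.2)) 0 j
  have hW : ∀ n ∈ N, ∀ s, W (relabel (ψ n) s) = w n s := by
    rintro n hn (i | j)
    · exact (hx n i).symm
    · exact (Set.InjOn.injective hψ).extend_apply (fun a => w a.1.1 (α a.1.2)) 0 ⟨(n, j), hn⟩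
  -- The block solutions represent `f - f(y_1)`; the constant `f(y_1)` is put into the fourth
  -- coordinate.
  refine ⟨fun i t => Fin.append (fun _ : Fin 4 => W) (fun _ : Fin k => 0) i t +
    if i = Fin.castAdd k 3 then f (place k id (y 1)) else 0, ?_⟩
  rintro _ ⟨n, hn, p, hp, rfl⟩
  rw [Finset.sum_add_distrib, Finset.sum_ite_eq' univ, if_pos (mem_univ _),
    sum_place (Fin.append (fun _ : Fin 4 => W) fun _ : Fin k => 0)]
  simp only [Fin.append_left, Fin.append_right, hW n hn, Pi.zero_apply, Finset.sum_const_zero]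
  have := hw n hn p hp
  rw [rowSum] at this
  rw [this]
  ring

theorem isFull_bouquet (hN : ∀ n ∈ N, 1 ≤ n) (hne : N.Nonempty) (hψ : Separates ψ N) :
    IsFull (bouquet k ψ N) := by
  obtain ⟨n, hn⟩ := hne
  exact (isGood_bouquet hN hψ).isFull ⟨_, place_mem_bouquet hn (z_mem_Sz n)⟩
    (hasConstantKernel_bouquet hN)

theorem isRelatedSet_bouquet (hN : ∀ n ∈ N, 1 ≤ n) (hψ : Separates ψ N) :
    IsRelatedSet (bouquet k ψ N) := by
  refine ⟨isGood_bouquet hN hψ, ?_⟩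
  rintro _ ⟨n, hn, p, hp, rfl⟩ _ ⟨m, hm, q, hq, rfl⟩
  have hsub : ({n, m} : Set ℕ) ⊆ N := by
    rintro a (rfl | rfl) <;> assumption
  -- The union of the two blocks involved is a finite full set containing both points.
  exact ⟨bouquet k ψ {n, m}, bouquet_mono hsub, bouquet_finite (Set.toFinite _),
    isFull_bouquet (fun a ha => hN a (hsub ha)) ⟨n, by simp⟩ (hψ.mono hsub),
    place_mem_bouquet (by simp) hp, place_mem_bouquet (by simp) hq⟩

/-- A full subset which contains `y_1` and the point `y_{4n}` of the block with number `n`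
contains the whole block. -/
theorem block_subset_of_isFull (hN : ∀ n ∈ N, 1 ≤ n) (hψ : Separates ψ N) {n : ℕ}
    (hn : n ∈ N) {F : Set (Fin (4 + k) → Symb)} (hFS : F ⊆ bouquet k ψ N) (hF : IsFull F)
    (h1 : place k (ψ n) (y 1) ∈ F) (h2 : place k (ψ n) (y (4 * n)) ∈ F) :
    bouquet k ψ {n} ⊆ F := by
  classical
  rintro _ ⟨_, rfl, r, hr, rfl⟩
  rename_i n
  by_contra hrF
  -- A solution for the indicator of a missing point is homogeneous on `F`, so it agrees at `y_1`
  -- and `y_{4n}` in each coordinate, contrary to `not_rowSum_indicator`.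
  obtain ⟨u, hu⟩ := isGood_iff.1 (isGood_bouquet hN hψ)
    fun P => if P = place k (ψ n) r then 1 else 0
  have huF : ∀ P ∈ F, ∑ i, u i (P i) = 0 := fun P hP => by
    rw [← hu P (hFS hP), if_neg]
    rintro rfl
    exact hrF hP
  have h4 : 1 ≤ 4 * n := by have := hN n hn; omega
  refine not_rowSum_indicator (hN n hn) (deviation_x u (ψ n)) (fun c => ?_) hr fun p hp => ?_
  · rw [deviation_apply u _ (col_y h4),
      hF.hasConstantKernel u huF _ _ h2 _ h1, sub_self]
  · rw [rowSum_deviation u _ (col_of_mem_Sz (hN n hn) hp), huF _ h1, sub_zero,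
      ← hu _ (place_mem_bouquet hn hp)]
    simp only [(place_injective (hψ.injective hn)).eq_iff]

theorem isGeodesic_bouquet (hN : ∀ n ∈ N, 1 ≤ n) (hψ : Separates ψ N) {n : ℕ}
    (hn : n ∈ N) :
    IsGeodesic (bouquet k ψ N) (place k (ψ n) (y 1)) (place k (ψ n) (y (4 * n)))
      (bouquet k ψ {n}) := by
  have h1 := hN n hn
  have hn' : ∀ m ∈ ({n} : Set ℕ), 1 ≤ m := by rintro _ rfl; exact h1
  have hsub : ({n} : Set ℕ) ⊆ N := by simpa using hn
  refine ⟨⟨bouquet_mono hsub, isRelatedSet_bouquet hn' (hψ.mono hsub),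
    place_mem_bouquet (Set.mem_singleton n) (y_mem_Sz le_rfl (by omega)),
    place_mem_bouquet (Set.mem_singleton n) (y_mem_Sz (by omega) le_rfl)⟩, ?_⟩
  rintro K ⟨hKS, hK, hp, hq⟩
  obtain ⟨F, hFK, -, hF, hpF, hqF⟩ := hK.2 _ hp _ hq
  exact (block_subset_of_isFull hN hψ hn (hFK.trans hKS) hF hpF hqF).trans hFK

theorem le_ncard_block (hψ : Separates ψ N) {n : ℕ} (hn : n ∈ N) :
    4 * n ≤ (bouquet k ψ {n}).ncard := by
  have h : (fun j => place k (ψ n) (y j)) '' Set.Icc 1 (4 * n) ⊆ bouquet k ψ {n} := by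
    rintro _ ⟨j, hj, rfl⟩
    exact place_mem_bouquet (Set.mem_singleton n) (y_mem_Sz hj.1 hj.2)
  refine le_trans (le_of_eq ?_) (Set.ncard_le_ncard h (bouquet_finite (Set.finite_singleton n)))
  rw [Set.InjOn.ncard_image]
  · simp
  · intro a ha b hb hab
    exact y_injOn ha.1 hb.1 (place_injective (hψ.injective hn) hab)

theorem hasUnboundedGeodesics_bouquet (hψ : Separates ψ (Set.Ici 1)) :
    HasUnboundedGeodesics (bouquet k ψ (Set.Ici 1)) := by
  intro m
  have hm : m + 1 ∈ Set.Ici 1 := Nat.le_add_left _ _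
  have hG := isGeodesic_bouquet (k := k) (N := Set.Ici 1) (fun n hn => hn) hψ hm
  refine ⟨_, hG.1.1 hG.1.2.2.1, _, hG.1.1 hG.1.2.2.2, _, hG,
    bouquet_finite (Set.finite_singleton _), ?_⟩
  have := le_ncard_block (k := k) hψ hm
  omega

end Bouquet

/-! ### The boundary of `S_{4n} ∪ {z}` -/

theorem isBoundary_Sz {n : ℕ} (hn : 1 ≤ n) (hgood : IsGood (Sz n))
    (hker : HasConstantKernel (Sz n)) : IsBoundary (Sz n) x123 := by
  have hy1 : y 1 ∈ Sz n := y_mem_Sz le_rfl (by omega)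
  refine ⟨hgood, ?_, fun U f => ⟨?_, ?_⟩⟩
  · rintro b (rfl | rfl | rfl) <;> exact ⟨y 1, hy1, rfl⟩
  · obtain ⟨u, hu⟩ := hgood f
    let a : Fin 4 → ℂ := ![U ⟨⟨0, x 0⟩, by simp [x123]⟩ - u 0 (x 0),
      U ⟨⟨1, x 1⟩, by simp [x123]⟩ - u 1 (x 1), U ⟨⟨2, x 2⟩, by simp [x123]⟩ - u 2 (x 2), 0]
    -- Adding constants with total sum 0 preserves solutions: three are prescribed by `U`, and the
    -- fourth coordinate balances them.
    refine ⟨fun i t => u i t + (a i - if i = 3 then ∑ c, a c else 0), fun p => ?_, ?_⟩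
    · rw [hu p, Finset.sum_add_distrib, Finset.sum_sub_distrib, Finset.sum_ite_eq' univ]
      simp
    · rintro ⟨b, rfl | rfl | rfl⟩ <;> simp [a]
  · rintro u v ⟨hu, huU⟩ ⟨hv, hvU⟩ i _ ⟨p, hp, rfl⟩
    have h0 : ∀ q ∈ Sz n, ∑ i, (u i (q i) - v i (q i)) = 0 := fun q hq => by
      rw [Finset.sum_sub_distrib, ← hu ⟨q, hq⟩, ← hv ⟨q, hq⟩, sub_self]
    have hb : ∀ b ∈ x123, u b.1 b.2 - v b.1 b.2 = 0 := fun b hb => by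
      rw [huU ⟨b, hb⟩, hvU ⟨b, hb⟩, sub_self]
    have b0 := hb ⟨0, x 0⟩ (by simp [x123])
    have b1 := hb ⟨1, x 1⟩ (by simp [x123])
    have b2 := hb ⟨2, x 2⟩ (by simp [x123])
    have hc := hker (fun i t => u i t - v i t) h0 i p hp (y 1) hy1
    refine sub_eq_zero.1 (hc.trans ?_)
    have h1 := h0 _ hy1
    simp only [Fin.sum_univ_four, y_one, Matrix.cons_val] at h1 b0 b1 b2 ⊢
    rw [b0, b1, b2] at h1
    fin_cases i
    · exact b0
    · exact b1
    · exact b2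
    · simpa using h1

end GoodSets

/-! ### Both claims as special cases of bouquets -/

theorem mainTheorem2 :
    (∀ n : ℕ, 1 ≤ n →
      GoodSets.IsFull (GoodSets.Sz n) ∧
      GoodSets.IsBoundary (GoodSets.Sz n) GoodSets.x123 ∧
      GoodSets.IsRelatedSet (GoodSets.Sz n) ∧
      GoodSets.IsGeodesic (GoodSets.Sz n) (GoodSets.y 1) (GoodSets.y (4 * n)) (GoodSets.Sz n) ∧
      IsUnit (GoodSets.A n) ∧
      ∀ i, ∑ j, |(GoodSets.A n)⁻¹ i j| ≤ 3) ∧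
    (∀ d : ℕ, 4 ≤ d →
      ∃ (X : Fin d → Type) (S : Set (∀ i, X i)),
        (∀ i, Nonempty (X i)) ∧
        GoodSets.IsFull S ∧
        GoodSets.IsRelatedSet S ∧
        GoodSets.HasUnboundedGeodesics S ∧
        GoodSets.HasBoundedSolutions S) := by
  open GoodSets in
  constructor
  · intro n hn
    have hN : ∀ m ∈ ({n} : Set ℕ), 1 ≤ m := by rintro _ rfl; exact hn
    have hψ : Separates (fun _ => id) {n} := by
      rintro ⟨_, i⟩ rfl ⟨_, j⟩ rfl h
      exact Prod.ext rfl h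
    have hfull := isFull_bouquet (k := 0) hN (Set.singleton_nonempty n) hψ
    have hker := hasConstantKernel_bouquet (k := 0) (ψ := fun _ => id) hN
    have hgeo := isGeodesic_bouquet (k := 0) hN hψ (Set.mem_singleton n)
    rw [bouquet_zero_singleton] at hfull hker hgeo
    rw [place_zero_id, place_zero_id] at hgeo
    exact ⟨hfull, isBoundary_Sz hn hfull.isGood hker, hgeo.1.2.1, hgeo, isUnit_A hn,
      sum_abs_inv_A_le hn⟩
  · intro d hd
    obtain ⟨k, rfl⟩ := Nat.exists_eq_add_of_le hd
    have hN : ∀ n ∈ Set.Ici 1, 1 ≤ n := fun n hn => hn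
    -- The pairing function provides injective renamings with disjoint ranges for infinitely many
    -- blocks.
    have hψ : Separates Nat.pair (Set.Ici 1) := fun a _ b _ h =>
      Prod.ext (Nat.pair_eq_pair.1 h).1 (Nat.pair_eq_pair.1 h).2
    exact ⟨fun _ => Symb, bouquet k Nat.pair (Set.Ici 1), fun _ => ⟨.x 0⟩,
      isFull_bouquet hN ⟨1, Set.self_mem_Ici⟩ hψ, isRelatedSet_bouquet hN hψ,
      hasUnboundedGeodesics_bouquet hψ, hasBoundedSolutions_bouquet hN⟩
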